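/- Let $d\ge 1$. A spacetime on $\mathbb{R}^{d+1}$ is a smooth Lorentzian metric $g$ (signature $(-,+,\dots,+)$) on $\mathbb{R}^{d+1}$. Write $g\simeq_{\mathrm{diff}}\tilde g$ if there is a smooth diffeomorphism $\varphi$ of $\mathbb{R}^{d+1}$ onto itself with $g=\varphi^*\tilde g$, i.e. $g_{\mu\nu}(x)=\partial_\mu\varphi^\rho(x)\,\partial_\nu\varphi^\sigma(x)\,\tilde g_{\rho\sigma}(\varphi(x))$. Sets of spacetimes carry the $C^\infty$ compact-open topology. A continuous action $G\curvearrowright X$ of a Polish group on a Polish space is *generically ergodic* if some orbit is dense and every orbit is meager. A set $\mathcal S$ of spacetimes is *rich* if there are a generically ergodic such action $G\curvearrowright X$ and a Borel map $r\colon X\to\mathcal S$ which is a reduction, that is, for all $a,b\in X$: $G\cdot a=G\cdot b \iff r(a)\simeq_{\mathrm{diff}} r(b)$. Let $\mathrm{RW}(\mathbb{R}^{d+1})$ be the set of all Robertson-Walker metrics $$-dt^2+J(t)\big((dx^1)^2+\cdots+(dx^d)^2\big),\qquad J\colon\mathbb{R}\to(0,\infty)\ \text{smooth}.$$ Let $\mathbb{Z}$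 act on $\{0,1\}^{\mathbb{Z}}$ (product topology) by the Bernoulli shift $(k\cdot\alpha)(n)=\alpha(n-k)$. Call $W\colon[0,1]\to[0,1]$ a *bell curve* if $W$ is smooth, $W$ and all its derivatives vanish at $0$ and $1$, $W(p)=1$ for a unique $p\in[0,1]$, this $p$ satisfies $p<1/2$, and the graph of the $1$-periodic extension of $W$ is not symmetric about any vertical axis. For $\alpha\in\{0,1\}^{\mathbb Z}$ set $W_\alpha(t)=2-W(t-\lfloor t\rfloor)$ if $\alpha(\lfloor t\rfloor)=0$ and $W_\alpha(t)=2+W(t-\lfloor t\rfloor)$ if $\alpha(\lfloor t\rfloor)=1$. Then: 1. $\mathrm{RW}(\mathbb{R}^{d+1})$ is rich. 2. The Bernoulli shift is a generically ergodic action of a Polish group on a Polish space, bell curves exist, and for every bell curve $W$ the assignment $r(\alpha)=-dt^2+W_\alpha(t)\sum_{i=1}^d(dx^i)^2$ is a well-defined continuous (hence Borel) map $r\colon\{0,1\}^{\mathbb{Z}}\to\mathrm{RW}(\mathbb{R}^{d+1})$ and a reduction of the orbit equivalence relation of the Bernoulli shift to $\simeq_{\mathrm{diff}}$. 3. More precisely,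 for every bell curve $W$ and all $\alpha,\beta\in\{0,1\}^{\mathbb Z}$, every diffeomorphism $\varphi$ of $\mathbb{R}^{d+1}$ with $r(\alpha)=\varphi^*r(\beta)$ shifts $t$ by an integer: there is $k\in\mathbb{Z}$ with $\varphi^0(t,x)=t-k$ for all $(t,x)$, and $\alpha(n)=\beta(n-k)$ for all $n\in\mathbb{Z}$. -/

import Mathlib

open Set
open scoped ContDiff Manifold

/-! ### Spacetimes on `ℝ^{d+1}` and general covariance -/

/-- The manifold `ℝ^{d+1}`, with coordinates `x 0 = t` and `x 1, …, x d`. -/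
abbrev Coord (d : ℕ) : Type := EuclideanSpace ℝ (Fin (d + 1))

/-- Bilinear forms on the tangent space `ℝ^{d+1}`. -/
abbrev BilForm (d : ℕ) : Type := Coord d →L[ℝ] Coord d →L[ℝ] ℝ

/-- Lorentzian signature `(-, +, …, +)`: there is a basis in which the form is
`diag (-1, 1, …, 1)`. -/
def IsLorentzian {d : ℕ} (B : BilForm d) : Prop :=
  ∃ e : Module.Basis (Fin (d + 1)) ℝ (Coord d), ∀ i j : Fin (d + 1),
    B (e i) (e j) = if i = j then (if i = 0 then -1 else 1) else 0

/-- A smooth spacetime supported on `ℝ^{d+1}`: a smooth Lorentzian metric tensor field. -/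
structure Spacetime (d : ℕ) where
  /-- the metric tensor at each point -/
  metric : Coord d → BilForm d
  smooth : ContDiff ℝ ∞ metric
  symm : ∀ x v w, metric x v w = metric x w v
  lorentzian : ∀ x, IsLorentzian (metric x)

/-- The `n`-th derivative of a smooth map, as a continuous map. -/
noncomputable def smoothJet {E F : Type} [NormedAddCommGroup E] [NormedSpace ℝ E]
    [NormedAddCommGroup F] [NormedSpace ℝ F] (n : ℕ) (f : {f : E → F // ContDiff ℝ ∞ f}) :
    C(E, ContinuousMultilinearMap ℝ (fun _ : Fin n => E) F) :=
  ⟨iteratedFDeriv ℝ n f.1,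
    f.2.continuous_iteratedFDeriv (by exact_mod_cast (le_top : (n : ℕ∞) ≤ ⊤))⟩

/-- The `C^∞` compact-open topology on smooth maps: uniform convergence on compact sets of the
maps together with all their derivatives. -/
noncomputable abbrev smoothTopology (E F : Type) [NormedAddCommGroup E] [NormedSpace ℝ E]
    [NormedAddCommGroup F] [NormedSpace ℝ F] : TopologicalSpace {f : E → F // ContDiff ℝ ∞ f} :=
  ⨅ n : ℕ, TopologicalSpace.induced (smoothJet n) inferInstance

/-- Spacetimes carry the `C^∞` compact-open topology of their metric tensor fields. -/
noncomputable instance Spacetime.instTopologicalSpace (d : ℕ) : TopologicalSpace (Spacetime d) :=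
  TopologicalSpace.induced (fun g => ⟨g.metric, g.smooth⟩)
    (smoothTopology (Coord d) (BilForm d))

/-- Smooth changes of coordinates of `ℝ^{d+1}` (diffeomorphisms onto itself). -/
abbrev CoordChange (d : ℕ) : Type :=
  Diffeomorph 𝓘(ℝ, Coord d) 𝓘(ℝ, Coord d) (Coord d) (Coord d) ∞

/-- The coordinate change `x ↦ φ x` carries `g` to `g'`, that is,
`g_{μν}(x) = ∂_μ φ^ρ(x) ∂_ν φ^σ(x) g'_{ρσ}(φ x)`. -/
def Transforms {d : ℕ} (φ : CoordChange d) (g g' : Spacetime d) : Prop :=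
  ∀ x v w : Coord d,
    g.metric x v w = g'.metric (φ x) (fderiv ℝ φ x v) (fderiv ℝ φ x w)

/-- General covariance `g ≃_diff g'`. -/
def DiffEquivalent {d : ℕ} (g g' : Spacetime d) : Prop :=
  ∃ φ : CoordChange d, Transforms φ g g'

/-! ### Rich families -/

/-- `G ↷ X` is a Polish `G`-space (a continuous action of a Polish group on a Polish space) which
is generically ergodic: some orbit is dense, and every orbit is meager. -/
structure IsGenericallyErgodicPolish (G X : Type) [Group G] [TopologicalSpace G]
    [TopologicalSpace X] [MulAction G X] : Prop where
  topologicalGroup : IsTopologicalGroup G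
  polish_group : PolishSpace G
  polish_space : PolishSpace X
  continuous_action : ContinuousSMul G X
  dense_orbit : ∃ x : X, Dense (MulAction.orbit G x)
  meagre_orbits : ∀ x : X, IsMeagre (MulAction.orbit G x)

/-- `r` is a Borel reduction of the orbit equivalence relation of `G ↷ X` to general covariance
on the family `S`, which carries the `C^∞` compact-open topology. -/
structure IsBorelReduction (G : Type) {X : Type} [Group G] [TopologicalSpace X] [MulAction G X]
    {d : ℕ} {S : Set (Spacetime d)} (r : X → S) : Prop where
  borel_map : @Measurable X S (borel X) (borel S) r
  reduces : ∀ a b : X, MulAction.orbit G a = MulAction.orbit G b ↔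
    DiffEquivalent (r a : Spacetime d) (r b : Spacetime d)

/-- A family of spacetimes is rich if the orbit equivalence relation of some generically ergodic
Polish `G`-space Borel reduces to general covariance on it. -/
def IsRich {d : ℕ} (S : Set (Spacetime d)) : Prop :=
  ∃ (G X : Type) (_ : Group G) (_ : TopologicalSpace G) (_ : TopologicalSpace X)
    (_ : MulAction G X),
    IsGenericallyErgodicPolish G X ∧ ∃ r : X → S, IsBorelReduction G r

/-! ### Robertson-Walker spacetimes -/

/-- `g = -dt² + J(t) ((dx¹)² + ⋯ + (dx^d)²)`. -/
def HasRWForm {d : ℕ} (J : ℝ → ℝ) (g : Spacetime d) : Prop :=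
  ∀ x v w : Coord d,
    g.metric x v w = -(v 0 * w 0) + J (x 0) * ∑ i : Fin d, v i.succ * w i.succ

/-- The family of all `(d+1)`-dimensional Robertson-Walker spacetimes. -/
def RW (d : ℕ) : Set (Spacetime d) :=
  {g | ∃ J : ℝ → ℝ, ContDiff ℝ ∞ J ∧ (∀ t, 0 < J t) ∧ HasRWForm J g}

/-! ### The Bernoulli shift and the functions `W_α` -/

/-- The space `{0,1}^ℤ` (with `1 = true`). -/
def Bernoulli : Type := ℤ → Bool

/-- The product topology. -/
instance Bernoulli.instTopologicalSpace : TopologicalSpace Bernoulli :=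
  inferInstanceAs (TopologicalSpace (ℤ → Bool))

/-- The shift action `(k · α)(n) = α (n - k)` of `ℤ` (written multiplicatively). -/
instance Bernoulli.instMulAction : MulAction (Multiplicative ℤ) Bernoulli where
  smul k α := fun n => α (n - k.toAdd)
  one_smul α := by
    funext n
    change α (n - 0) = α n
    rw [sub_zero]
  mul_smul k l α := by
    funext n
    change α (n - (k.toAdd + l.toAdd)) = α (n - k.toAdd - l.toAdd)
    rw [sub_sub]

/-- The bell curves `W : [0,1] → [0,1]` (values of `W` outside `[0,1]` are irrelevant). -/
structure IsBellCurve (W : ℝ → ℝ) : Prop where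
  smooth : ContDiffOn ℝ ∞ W (Icc 0 1)
  mapsTo : MapsTo W (Icc 0 1) (Icc 0 1)
  flat_zero : ∀ n : ℕ, iteratedDerivWithin n W (Icc 0 1) 0 = 0
  flat_one : ∀ n : ℕ, iteratedDerivWithin n W (Icc 0 1) 1 = 0
  peak : ∃ p ∈ Icc (0 : ℝ) 1, p < 1 / 2 ∧ W p = 1 ∧ ∀ x ∈ Icc (0 : ℝ) 1, W x = 1 → x = p
  /-- the graph of the `1`-periodic extension of `W` has no vertical axis of symmetry -/
  asymmetric : ¬ ∃ c : ℝ, ∀ t : ℝ, W (Int.fract (2 * c - t)) = W (Int.fract t)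

/-- `W_α(t) = 2 - W(t - ⌊t⌋)` if `α(⌊t⌋) = 0`, and `2 + W(t - ⌊t⌋)` if `α(⌊t⌋) = 1`. -/
noncomputable def bellWave (W : ℝ → ℝ) (α : Bernoulli) (t : ℝ) : ℝ :=
  if α ⌊t⌋ = true then 2 + W (t - ⌊t⌋) else 2 - W (t - ⌊t⌋)

/-!
The field `a(t) ∂_t` is concircular: its covariant derivative is `a'(t) • id`. This is a
diffeomorphism-invariant property, so a transformation from `-dt² + a² dx²` to `-dt² + b² dx²` pulls
`b(t) ∂_t` back to a field `Z` that is concircular for `-dt² + a² dx²`. Comparing second derivatives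
shows that the spatial components of `Z` vanish unless `a'² - a a''` is constant, that is, unless
`(a'/a)' = -κ / a²` with `κ` constant. Then `a'/a` is monotone, which is impossible for a
nonconstant `a` with two critical points. (For `d = 1` and `a = cosh`, with only one critical point,
one gets the universal cover of two-dimensional de Sitter space, whose symmetries mix time and
space.) So `Z` is proportional to `∂_t`; it follows that the transformation acts on time by
`t ↦ ± t + r` and that `a` is a constant multiple of `b (± t + r)`.

For `a² = W_α` and `b² = W_β` the extreme values show that the constant is `1`, the asymmetry of the
bell curve excludes the sign `-1`, and the unique peak of the bell curve in each period makes `r` an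
integer.
-/

/-! ### Calculus -/

section Calculus

variable {E F : Type*} [NormedAddCommGroup E] [NormedSpace ℝ E] [NormedAddCommGroup F]
  [NormedSpace ℝ F]

theorem fderiv_fderiv_comm {f : E → F} {x : E} (hf : ContDiffAt ℝ 2 f x) (u v : E) :
    fderiv ℝ (fun y => fderiv ℝ f y u) x v = fderiv ℝ (fun y => fderiv ℝ f y v) x u := by
  have hd : DifferentiableAt ℝ (fderiv ℝ f) x :=
    (hf.fderiv_right (m := 1) (by norm_num)).differentiableAt one_ne_zero
  rw [fderiv_clm_apply hd (differentiableAt_const _),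
    fderiv_clm_apply hd (differentiableAt_const _)]
  simpa using hf.isSymmSndFDerivAt (by simp) v u

theorem periodic_fderiv {f : E → F} {c : E} (hf : Function.Periodic f c) :
    Function.Periodic (fderiv ℝ f) c := fun x => by
  rw [← fderiv_comp_add_right, funext hf]

theorem deriv_eq_zero_of_sq_deriv_sub_mul_deriv_deriv_eq_const {a : ℝ → ℝ}
    (ha : Differentiable ℝ a) (ha' : Differentiable ℝ (deriv a)) (hpos : ∀ t, 0 < a t) {κ : ℝ}
    (hκ : ∀ t, deriv a t ^ 2 - a t * deriv (deriv a) t = κ) {s t : ℝ} (hst : s < t)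
    (hs : deriv a s = 0) (ht : deriv a t = 0) (r : ℝ) : deriv a r = 0 := by
  have hlog (r : ℝ) : HasDerivAt (fun r => deriv a r / a r) (-κ / a r ^ 2) r := by
    refine ((ha' r).hasDerivAt.div (ha r).hasDerivAt (hpos r).ne').congr_deriv ?_
    rw [← hκ r]
    ring
  have hκ0 : κ = 0 := by
    obtain ⟨c, -, hc⟩ := exists_hasDerivAt_eq_zero hst
      (fun r _ => (hlog r).continuousAt.continuousWithinAt) (by rw [hs, ht, zero_div, zero_div])
      (fun r _ => hlog r)
    simpa [(hpos c).ne'] using hc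
  have hconst := is_const_of_deriv_eq_zero (fun r => (hlog r).differentiableAt)
    (fun r => by rw [(hlog r).deriv, hκ0, neg_zero, zero_div]) r s
  simpa [hs, (hpos r).ne'] using hconst

end Calculus

/-! ### Concircular vector fields -/

section Concircular

variable {E : Type*} [NormedAddCommGroup E] [NormedSpace ℝ E]

/-- The bilinear form `(v, w) ↦ g(∇_v Z, w)` at `x`, where `∇` is the Levi-Civita connection of the
metric tensor field `g`, given by the Christoffel formula. -/
noncomputable def leviCivitaForm (g : E → E →L[ℝ] E →L[ℝ] ℝ) (Z : E → E) (x v w : E) : ℝ :=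
  g x (fderiv ℝ Z x v) w +
    (fderiv ℝ g x v (Z x) w + fderiv ℝ g x (Z x) v w - fderiv ℝ g x w (Z x) v) / 2

/-- A vector field `Z` is concircular with coefficient `μ` if `∇_v Z = μ v` for all `v`. -/
structure IsConcircular (g : E → E →L[ℝ] E →L[ℝ] ℝ) (Z : E → E) (μ : E → ℝ) : Prop where
  contDiff : ContDiff ℝ ∞ Z
  leviCivitaForm_eq : ∀ x v w, leviCivitaForm g Z x v w = μ x * g x v w

variable {F : Type*} [NormedAddCommGroup F] [NormedSpace ℝ F]

theorem fderiv_pullback_form {g : E → E →L[ℝ] E →L[ℝ] ℝ} {g' : F → F →L[ℝ] F →L[ℝ] ℝ}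
    {φ : E → F} {x : E}
    (hg : DifferentiableAt ℝ g x) (hg' : DifferentiableAt ℝ g' (φ x)) (hφ : ContDiffAt ℝ 2 φ x)
    (h : ∀ y v w, g y v w = g' (φ y) (fderiv ℝ φ y v) (fderiv ℝ φ y w)) (u v w : E) :
    fderiv ℝ g x u v w =
      fderiv ℝ g' (φ x) (fderiv ℝ φ x u) (fderiv ℝ φ x v) (fderiv ℝ φ x w) +
        g' (φ x) (fderiv ℝ (fderiv ℝ φ) x u v) (fderiv ℝ φ x w) +
        g' (φ x) (fderiv ℝ φ x v) (fderiv ℝ (fderiv ℝ φ) x u w) := by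
  have hA : HasFDerivAt (fderiv ℝ φ) (fderiv ℝ (fderiv ℝ φ) x) x :=
    ((hφ.fderiv_right (m := 1) (by norm_num)).differentiableAt one_ne_zero).hasFDerivAt
  have happly (v : E) := hA.clm_apply (hasFDerivAt_const v x)
  have hl := (hg.hasFDerivAt.clm_apply (hasFDerivAt_const v x)).clm_apply (hasFDerivAt_const w x)
  have hgφ : HasFDerivAt (fun y => g' (φ y)) (fderiv ℝ g' (φ x) ∘L fderiv ℝ φ x) x :=
    HasFDerivAt.comp (G := F →L[ℝ] F →L[ℝ] ℝ) x hg'.hasFDerivAt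
      (hφ.differentiableAt two_ne_zero).hasFDerivAt
  have hr := (hgφ.clm_apply (happly v)).clm_apply (happly w)
  have heq := hl.unique (hr.congr_of_eventuallyEq (.of_forall fun y => h y v w))
  simpa [add_assoc, add_comm, add_left_comm] using DFunLike.congr_fun heq u

theorem leviCivitaForm_pullback {g : E → E →L[ℝ] E →L[ℝ] ℝ} {g' : F → F →L[ℝ] F →L[ℝ] ℝ}
    {φ : E → F} {Z : E → E} {V : F → F} {x : E}
    (hg : DifferentiableAt ℝ g x) (hg' : DifferentiableAt ℝ g' (φ x)) (hφ : ContDiffAt ℝ 2 φ x)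
    (hZ : DifferentiableAt ℝ Z x) (hV : DifferentiableAt ℝ V (φ x))
    (hsymm : ∀ v w, g' (φ x) v w = g' (φ x) w v)
    (h : ∀ y v w, g y v w = g' (φ y) (fderiv ℝ φ y v) (fderiv ℝ φ y w))
    (hZV : ∀ y, fderiv ℝ φ y (Z y) = V (φ y)) (v w : E) :
    leviCivitaForm g Z x v w =
      leviCivitaForm g' V (φ x) (fderiv ℝ φ x v) (fderiv ℝ φ x w) := by
  have hA : HasFDerivAt (fderiv ℝ φ) (fderiv ℝ (fderiv ℝ φ) x) x :=
    ((hφ.fderiv_right (m := 1) (by norm_num)).differentiableAt one_ne_zero).hasFDerivAt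
  have hDA : ∀ u v, fderiv ℝ (fderiv ℝ φ) x u v = fderiv ℝ (fderiv ℝ φ) x v u :=
    hφ.isSymmSndFDerivAt (by simp)
  have hDV : fderiv ℝ φ x (fderiv ℝ Z x v) + fderiv ℝ (fderiv ℝ φ) x v (Z x) =
      fderiv ℝ V (φ x) (fderiv ℝ φ x v) := by
    have heq := (hA.clm_apply hZ.hasFDerivAt).unique
      ((hV.hasFDerivAt.comp x (hφ.differentiableAt two_ne_zero).hasFDerivAt).congr_of_eventuallyEq
        (.of_forall hZV))
    simpa using DFunLike.congr_fun heq v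
  have hDg := fderiv_pullback_form hg hg' hφ h
  simp only [leviCivitaForm, hDg, h x, ← hZV x, ← hDV, map_add, add_apply]
  rw [hDA v (Z x), hDA w (Z x), hDA w v, hsymm _ (fderiv ℝ φ x v)]
  ring

end Concircular

/-- The pullback `Dφ⁻¹ (V ∘ φ)` of a vector field along a change of coordinates. -/
noncomputable def pullbackField {d : ℕ} (φ : CoordChange d) (V : Coord d → Coord d)
    (x : Coord d) : Coord d :=
  fderiv ℝ φ.symm (φ x) (V (φ x))

section PullbackField

variable {d : ℕ} (φ : CoordChange d) {V : Coord d → Coord d}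

theorem contDiff_pullbackField (hV : ContDiff ℝ ∞ V) : ContDiff ℝ ∞ (pullbackField φ V) := by
  have hφ : ContDiff ℝ ∞ φ := φ.contMDiff.contDiff
  have hsymm : ContDiff ℝ ∞ (fderiv ℝ φ.symm) := φ.symm.contMDiff.contDiff.fderiv_right le_rfl
  exact (hsymm.comp hφ).clm_apply (hV.comp hφ)

theorem fderiv_pullbackField (V : Coord d → Coord d) (x : Coord d) :
    fderiv ℝ φ x (pullbackField φ V x) = V (φ x) := by
  have hφ : HasFDerivAt φ (fderiv ℝ φ x) (φ.symm (φ x)) := by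
    rw [φ.symm_apply_apply]
    exact (φ.contMDiff.contDiff.differentiable (by simp) x).hasFDerivAt
  have hsymm := (φ.symm.contMDiff.contDiff.differentiable (by simp) (φ x)).hasFDerivAt
  have hid := (hφ.comp (φ x) hsymm).congr_of_eventuallyEq
    (.of_forall fun y => (φ.apply_symm_apply y).symm)
  exact DFunLike.congr_fun (hid.unique (hasFDerivAt_id (φ x))) (V (φ x))

theorem IsConcircular.pullbackField {g g' : Spacetime d} {φ : CoordChange d}
    (h : Transforms φ g g') {μ : Coord d → ℝ} (hV : IsConcircular g'.metric V μ) :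
    IsConcircular g.metric (pullbackField φ V) (μ ∘ φ) where
  contDiff := contDiff_pullbackField φ hV.contDiff
  leviCivitaForm_eq x v w := by
    rw [leviCivitaForm_pullback (g.smooth.differentiable (by simp) x)
      (g'.smooth.differentiable (by simp) _)
      (contDiff_infty.1 φ.contMDiff.contDiff 2).contDiffAt
      ((contDiff_pullbackField φ hV.contDiff).differentiable (by simp) x)
      (hV.contDiff.differentiable (by simp) _) (g'.symm _) h (fderiv_pullbackField φ V) v w,
      hV.leviCivitaForm_eq, h x v w, Function.comp_apply]

end PullbackField

/-! ### Robertson-Walker spacetimes -/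

/-- The unit vector `∂_t`. -/
noncomputable def timeVec (d : ℕ) : Coord d := EuclideanSpace.single 0 1

/-- The unit vector `∂_i` of the `i`-th spatial coordinate. -/
noncomputable def spaceVec {d : ℕ} (i : Fin d) : Coord d := EuclideanSpace.single i.succ 1

@[simp] theorem timeVec_zero (d : ℕ) : timeVec d 0 = 1 := by simp [timeVec]

@[simp] theorem timeVec_succ {d : ℕ} (i : Fin d) : timeVec d i.succ = 0 := by
  simp [timeVec]

@[simp] theorem spaceVec_zero {d : ℕ} (i : Fin d) : spaceVec i 0 = 0 := by
  simp [spaceVec, (Fin.succ_ne_zero i).symm]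

@[simp] theorem spaceVec_succ {d : ℕ} (i j : Fin d) :
    spaceVec i j.succ = if j = i then 1 else 0 := by
  simp [spaceVec]

theorem fderiv_apply_coord {d : ℕ} {Z : Coord d → Coord d} {x : Coord d}
    (hZ : DifferentiableAt ℝ Z x) (j : Fin (d + 1)) (v : Coord d) :
    fderiv ℝ (fun y => Z y j) x v = fderiv ℝ Z x v j :=
  DFunLike.congr_fun
    ((EuclideanSpace.proj (𝕜 := ℝ) j).hasFDerivAt.comp x hZ.hasFDerivAt).fderiv v

theorem hasFDerivAt_comp_time {d : ℕ} {f : ℝ → ℝ} {f' : ℝ} {x : Coord d}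
    (hf : HasDerivAt f f' (x 0)) :
    HasFDerivAt (fun y : Coord d => f (y 0)) (f' • EuclideanSpace.proj (𝕜 := ℝ) 0) x :=
  hf.comp_hasFDerivAt x (EuclideanSpace.proj (𝕜 := ℝ) (0 : Fin (d + 1))).hasFDerivAt

theorem fderiv_comp_time_mul {d : ℕ} {f : ℝ → ℝ} {h : Coord d → ℝ} {x : Coord d}
    (hf : DifferentiableAt ℝ f (x 0)) (hh : DifferentiableAt ℝ h x) (v : Coord d) :
    fderiv ℝ (fun y : Coord d => f (y 0) * h y) x v =
      f (x 0) * fderiv ℝ h x v + deriv f (x 0) * v 0 * h x := by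
  have hmul : fderiv ℝ (fun y : Coord d => f (y 0) * h y) x v =
      f (x 0) * fderiv ℝ h x v + h x * (deriv f (x 0) * v 0) :=
    DFunLike.congr_fun ((hasFDerivAt_comp_time hf.hasDerivAt).mul hh.hasFDerivAt).fderiv v
  rw [hmul, mul_comm (h x)]

/-- `g = -dt² + a(t)² ((dx¹)² + ⋯ + (dx^d)²)` for a smooth positive scale factor `a`, that is,
`a = √J` in the notation of `HasRWForm`. -/
structure HasScaleFactor {d : ℕ} (a : ℝ → ℝ) (g : Spacetime d) : Prop where
  contDiff : ContDiff ℝ ∞ a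
  pos : ∀ t, 0 < a t
  hasRWForm : HasRWForm (fun t => a t ^ 2) g

theorem HasRWForm.hasScaleFactor_sqrt {d : ℕ} {J : ℝ → ℝ} {g : Spacetime d}
    (hg : HasRWForm J g) (hJ : ContDiff ℝ ∞ J) (hpos : ∀ t, 0 < J t) :
    HasScaleFactor (fun t => √(J t)) g where
  contDiff := hJ.sqrt fun t => (hpos t).ne'
  pos t := Real.sqrt_pos.2 (hpos t)
  hasRWForm x v w := by simp only [hg x v w, Real.sq_sqrt (hpos _).le]

theorem IsConcircular.contDiff_coord {d : ℕ} {g : Coord d → BilForm d} {Z : Coord d → Coord d}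
    {μ : Coord d → ℝ} (hZ : IsConcircular g Z μ) (j : Fin (d + 1)) : ContDiff ℝ ∞ fun y => Z y j :=
  (EuclideanSpace.proj (𝕜 := ℝ) j).contDiff.comp hZ.contDiff

namespace HasScaleFactor

variable {d : ℕ} {a : ℝ → ℝ} {g : Spacetime d}

theorem hasDerivAt (hg : HasScaleFactor a g) (t : ℝ) : HasDerivAt a (deriv a t) t :=
  (hg.contDiff.differentiable (by simp) t).hasDerivAt

theorem differentiable_deriv (hg : HasScaleFactor a g) : Differentiable ℝ (deriv a) :=
  (contDiff_infty_iff_deriv.1 hg.contDiff).2.differentiable (by simp)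

theorem fderiv_metric_apply (hg : HasScaleFactor a g) (x u v w : Coord d) :
    fderiv ℝ g.metric x u v w =
      2 * a (x 0) * deriv a (x 0) * u 0 * ∑ i : Fin d, v i.succ * w i.succ := by
  have hmetric := (g.smooth.differentiable (by simp) x).hasFDerivAt
  have hl := (hmetric.clm_apply (hasFDerivAt_const v x)).clm_apply (hasFDerivAt_const w x)
  have hr := ((hasFDerivAt_comp_time ((hg.hasDerivAt (x 0)).fun_pow 2)).mul_const
    (∑ i : Fin d, v i.succ * w i.succ)).const_add (-(v 0 * w 0))
  have heq := hl.unique (hr.congr_of_eventuallyEq (.of_forall fun y => hg.hasRWForm y v w))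
  calc fderiv ℝ g.metric x u v w = _ := by simpa using DFunLike.congr_fun heq u
    _ = _ := by ring

theorem metric_apply_timeVec (hg : HasScaleFactor a g) (x v : Coord d) :
    g.metric x v (timeVec d) = -v 0 := by
  simp [hg.hasRWForm x]

theorem metric_apply_spaceVec (hg : HasScaleFactor a g) (x v : Coord d) (i : Fin d) :
    g.metric x v (spaceVec i) = a (x 0) ^ 2 * v i.succ := by
  simp [hg.hasRWForm x]

theorem isConcircular_smul_timeVec (hg : HasScaleFactor a g) :
    IsConcircular g.metric (fun x => a (x 0) • timeVec d) (fun x => deriv a (x 0)) where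
  contDiff := (hg.contDiff.comp (EuclideanSpace.proj (𝕜 := ℝ) (0 : Fin (d + 1))).contDiff).smul
    contDiff_const
  leviCivitaForm_eq x v w := by
    have hZ := (hasFDerivAt_comp_time (hg.hasDerivAt (x 0))).smul_const (timeVec d)
    rw [leviCivitaForm, hZ.fderiv]
    simp only [ContinuousLinearMap.smulRight_apply, smul_apply, PiLp.proj_apply, smul_eq_mul,
      map_smul, hg.hasRWForm x, hg.fderiv_metric_apply, timeVec_zero, timeVec_succ, zero_mul,
      mul_zero, Finset.sum_const_zero]
    ring

section ConcircularField

variable {Z : Coord d → Coord d} {μ : Coord d → ℝ}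

theorem fderiv_time (hg : HasScaleFactor a g) (hZ : IsConcircular g.metric Z μ) (x v : Coord d) :
    fderiv ℝ (fun y => Z y 0) x v =
      μ x * v 0 - deriv a (x 0) * ∑ i : Fin d, a (x 0) * Z x i.succ * v i.succ := by
  have h : -fderiv ℝ Z x v 0 -
      a (x 0) * deriv a (x 0) * ∑ i : Fin d, Z x i.succ * v i.succ = -(μ x * v 0) := by
    rw [← mul_neg, ← hg.metric_apply_timeVec x v, ← hZ.leviCivitaForm_eq, leviCivitaForm,
      hg.metric_apply_timeVec]
    simp only [hg.fderiv_metric_apply, timeVec_zero, timeVec_succ, mul_zero,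
      Finset.sum_const_zero]
    ring
  simp only [mul_assoc, ← Finset.mul_sum] at h ⊢
  rw [fderiv_apply_coord (hZ.contDiff.differentiable (by simp) x)]
  linarith

theorem fderiv_mul_space (hg : HasScaleFactor a g) (hZ : IsConcircular g.metric Z μ)
    (i : Fin d) (x v : Coord d) :
    fderiv ℝ (fun y => a (y 0) * Z y i.succ) x v =
      (a (x 0) * μ x - deriv a (x 0) * Z x 0) * v i.succ := by
  have h : a (x 0) ^ 2 * fderiv ℝ Z x v i.succ +
      a (x 0) * deriv a (x 0) * (v 0 * Z x i.succ + Z x 0 * v i.succ) =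
        μ x * (a (x 0) ^ 2 * v i.succ) := by
    rw [← hg.metric_apply_spaceVec x v, ← hZ.leviCivitaForm_eq, leviCivitaForm,
      hg.metric_apply_spaceVec]
    simp only [hg.fderiv_metric_apply, spaceVec_zero, spaceVec_succ, mul_ite, mul_one, mul_zero,
      zero_mul, Finset.sum_ite_eq', Finset.mem_univ, if_true]
    ring
  refine mul_left_cancel₀ (hg.pos (x 0)).ne' ?_
  rw [fderiv_comp_time_mul (hg.hasDerivAt _).differentiableAt
    (hZ.contDiff_coord i.succ |>.differentiable (by simp) x),
    fderiv_apply_coord (hZ.contDiff.differentiable (by simp) x)]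
  linear_combination h

theorem contDiff_mul_space (hg : HasScaleFactor a g) (hZ : IsConcircular g.metric Z μ)
    (i : Fin d) : ContDiff ℝ ∞ fun x => a (x 0) * Z x i.succ :=
  (hg.contDiff.comp (EuclideanSpace.proj (𝕜 := ℝ) (0 : Fin (d + 1))).contDiff).mul
    (hZ.contDiff_coord i.succ)

theorem coeff_eq_fderiv_time (hg : HasScaleFactor a g) (hZ : IsConcircular g.metric Z μ) :
    μ = fun x => fderiv ℝ (fun y => Z y 0) x (timeVec d) :=
  funext fun x => by simp [hg.fderiv_time hZ]

theorem differentiable_coeff (hg : HasScaleFactor a g) (hZ : IsConcircular g.metric Z μ) :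
    Differentiable ℝ μ := by
  have hZ' : ContDiff ℝ ∞ (fderiv ℝ fun y => Z y 0) :=
    (hZ.contDiff_coord 0).fderiv_right le_rfl
  rw [hg.coeff_eq_fderiv_time hZ]
  exact (hZ'.clm_apply contDiff_const).differentiable (by simp)

theorem fderiv_coeff_spaceVec (hg : HasScaleFactor a g) (hZ : IsConcircular g.metric Z μ)
    (i : Fin d) (x : Coord d) :
    fderiv ℝ μ x (spaceVec i) = -deriv (deriv a) (x 0) * (a (x 0) * Z x i.succ) := by
  have hQ : Differentiable ℝ fun y => a (y 0) * Z y i.succ :=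
    (hg.contDiff_mul_space hZ i).differentiable (by simp)
  have hspace : (fun y => fderiv ℝ (fun y => Z y 0) y (spaceVec i)) =
      fun y => -deriv a (y 0) * (a (y 0) * Z y i.succ) :=
    funext fun y => by simp [hg.fderiv_time hZ]
  rw [hg.coeff_eq_fderiv_time hZ,
    fderiv_fderiv_comm (contDiff_infty.1 (hZ.contDiff_coord 0) 2).contDiffAt, hspace,
    fderiv_comp_time_mul (f := fun t => -deriv a t) (hg.differentiable_deriv.neg _) (hQ x)]
  simp [hg.fderiv_mul_space hZ, deriv.fun_neg]

theorem fderiv_fderiv_mul_space (hg : HasScaleFactor a g) (hZ : IsConcircular g.metric Z μ)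
    (i : Fin d) (x : Coord d) :
    fderiv ℝ (fun y => fderiv ℝ (fun z => a (z 0) * Z z i.succ) y (spaceVec i)) x (spaceVec i) =
      (deriv a (x 0) ^ 2 - a (x 0) * deriv (deriv a) (x 0)) * (a (x 0) * Z x i.succ) := by
  have hZ0 : Differentiable ℝ fun y => Z y 0 := (hZ.contDiff_coord 0).differentiable (by simp)
  have hQσ : (fun y => fderiv ℝ (fun z => a (z 0) * Z z i.succ) y (spaceVec i)) =
      fun y => a (y 0) * μ y - deriv a (y 0) * Z y 0 :=
    funext fun y => by simp [hg.fderiv_mul_space hZ]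
  have hμ := hg.differentiable_coeff hZ x
  have ha := (hg.hasDerivAt (x 0)).differentiableAt
  have ha' := hg.differentiable_deriv (x 0)
  rw [hQσ, fderiv_fun_sub ((hasFDerivAt_comp_time ha.hasDerivAt).differentiableAt.fun_mul hμ)
      ((hasFDerivAt_comp_time ha'.hasDerivAt).differentiableAt.fun_mul (hZ0 x)), sub_apply,
    fderiv_comp_time_mul ha hμ, fderiv_comp_time_mul ha' (hZ0 x), hg.fderiv_coeff_spaceVec hZ,
    hg.fderiv_time hZ]
  simp only [spaceVec_zero, spaceVec_succ, mul_ite, mul_one, mul_zero, zero_mul,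
    Finset.sum_ite_eq', Finset.mem_univ, if_true]
  ring

theorem periodic_mul_space (hg : HasScaleFactor a g) (hZ : IsConcircular g.metric Z μ)
    (i : Fin d) (t : ℝ) :
    Function.Periodic (fun x => a (x 0) * Z x i.succ) (t • timeVec d) := by
  intro x
  have hline (s : ℝ) : HasDerivAt (fun s : ℝ => x + s • timeVec d) (timeVec d) s := by
    simpa using ((hasDerivAt_id s).smul_const (timeVec d)).const_add x
  have hderiv (s : ℝ) := (((hg.contDiff_mul_space hZ i).differentiable (by simp)
    (x + s • timeVec d)).hasFDerivAt.comp_hasDerivAt s (hline s))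
  have hconst := is_const_of_deriv_eq_zero (fun s => (hderiv s).differentiableAt)
    (fun s => by rw [(hderiv s).deriv, hg.fderiv_mul_space hZ, timeVec_succ, mul_zero]) t 0
  simpa using hconst

theorem deriv_sq_sub_mul_deriv_deriv_eq (hg : HasScaleFactor a g)
    (hZ : IsConcircular g.metric Z μ) {i : Fin d} {x : Coord d} (hx : Z x i.succ ≠ 0) (s t : ℝ) :
    deriv a s ^ 2 - a s * deriv (deriv a) s = deriv a t ^ 2 - a t * deriv (deriv a) t := by
  have hconst (r : ℝ) : deriv a r ^ 2 - a r * deriv (deriv a) r =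
      deriv a (x 0) ^ 2 - a (x 0) * deriv (deriv a) (x 0) := by
    have hQ := hg.periodic_mul_space hZ i (r - x 0)
    have hQx : a ((x + (r - x 0) • timeVec d) 0) * Z (x + (r - x 0) • timeVec d) i.succ =
        a (x 0) * Z x i.succ := hQ x
    have hQσ : Function.Periodic (fun y => fderiv ℝ (fun z => a (z 0) * Z z i.succ) y (spaceVec i))
        ((r - x 0) • timeVec d) :=
      fun y => congrArg (· (spaceVec i)) (periodic_fderiv hQ y)
    have h := DFunLike.congr_fun (periodic_fderiv hQσ x) (spaceVec i)
    rw [hg.fderiv_fderiv_mul_space hZ, hg.fderiv_fderiv_mul_space hZ, hQx] at h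
    simpa using mul_right_cancel₀ (mul_ne_zero (hg.pos _).ne' hx) h
  exact (hconst s).trans (hconst t).symm

theorem space_eq_zero (hg : HasScaleFactor a g) (hZ : IsConcircular g.metric Z μ) {s t : ℝ}
    (hst : s < t) (hs : deriv a s = 0) (ht : deriv a t = 0) {u : ℝ} (hu : deriv a u ≠ 0)
    (i : Fin d) (x : Coord d) : Z x i.succ = 0 := by
  by_contra hx
  have ha := hg.contDiff.differentiable (by simp)
  exact hu (deriv_eq_zero_of_sq_deriv_sub_mul_deriv_deriv_eq_const ha hg.differentiable_deriv
    hg.pos (fun r => hg.deriv_sq_sub_mul_deriv_deriv_eq hZ hx r 0) hst hs ht u)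

end ConcircularField

end HasScaleFactor

section Rigidity

variable {d : ℕ} {a b : ℝ → ℝ} {g g' : Spacetime d} {φ : CoordChange d}

/-- The pullback of the concircular field `b(t) ∂_t`. -/
noncomputable def pullbackTime (φ : CoordChange d) (b : ℝ → ℝ) : Coord d → Coord d :=
  pullbackField φ fun y => b (y 0) • timeVec d

theorem isConcircular_pullbackTime (hg' : HasScaleFactor b g') (h : Transforms φ g g') :
    IsConcircular g.metric (pullbackTime φ b) fun x => deriv b (φ x 0) :=
  hg'.isConcircular_smul_timeVec.pullbackField h

theorem metric_pullbackTime (hg' : HasScaleFactor b g') (h : Transforms φ g g') (x v : Coord d) :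
    g.metric x v (pullbackTime φ b x) = -(b (φ x 0) * fderiv ℝ φ x v 0) := by
  rw [h x, pullbackTime, fderiv_pullbackField, map_smul, hg'.metric_apply_timeVec, smul_eq_mul,
    mul_neg]

theorem pullbackTime_zero_mul (hg : HasScaleFactor a g) (hg' : HasScaleFactor b g')
    (h : Transforms φ g g') (hspace : ∀ x (i : Fin d), pullbackTime φ b x i.succ = 0)
    (x v : Coord d) : pullbackTime φ b x 0 * v 0 = b (φ x 0) * fderiv ℝ φ x v 0 := by
  have hpair := metric_pullbackTime hg' h x v
  simp only [hg.hasRWForm x, hspace, mul_zero, Finset.sum_const_zero, add_zero, neg_inj] at hpair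
  rw [mul_comm, hpair]

theorem exists_sign_pullbackTime_zero (hg : HasScaleFactor a g) (hg' : HasScaleFactor b g')
    (h : Transforms φ g g') (hspace : ∀ x (i : Fin d), pullbackTime φ b x i.succ = 0) :
    ∃ ε : ℝ, (ε = 1 ∨ ε = -1) ∧ ∀ x, pullbackTime φ b x 0 = ε * b (φ x 0) := by
  have hsq (x : Coord d) : pullbackTime φ b x 0 ^ 2 = b (φ x 0) ^ 2 := by
    rw [sq, pullbackTime_zero_mul hg hg' h hspace, pullbackTime, fderiv_pullbackField]
    simp [sq]
  have hp : Continuous fun x => pullbackTime φ b x 0 :=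
    ((isConcircular_pullbackTime hg' h).contDiff_coord 0).continuous
  have hb : Continuous fun x => b (φ x 0) :=
    hg'.contDiff.continuous.comp
      ((EuclideanSpace.proj (𝕜 := ℝ) (0 : Fin (d + 1))).continuous.comp φ.continuous)
  rcases isPreconnected_univ.eq_or_eq_neg_of_sq_eq hp.continuousOn hb.continuousOn
    (fun x _ => hsq x) (fun _ => (hg'.pos _).ne') with hpos | hneg
  · exact ⟨1, .inl rfl, fun x => by simpa using hpos (mem_univ x)⟩
  · exact ⟨-1, .inr rfl, fun x => by simpa using hneg (mem_univ x)⟩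

theorem coordChange_time_eq (hg : HasScaleFactor a g) (hg' : HasScaleFactor b g')
    (h : Transforms φ g g') (hspace : ∀ x (i : Fin d), pullbackTime φ b x i.succ = 0) {ε : ℝ}
    (hε : ∀ x, pullbackTime φ b x 0 = ε * b (φ x 0)) (x : Coord d) :
    φ x 0 = ε * x 0 + φ 0 0 := by
  have hφ : Differentiable ℝ φ := φ.contMDiff.contDiff.differentiable (by simp)
  have hderiv (x v : Coord d) : fderiv ℝ φ x v 0 = ε * v 0 := by
    have hv := pullbackTime_zero_mul hg hg' h hspace x v
    rw [hε] at hv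
    refine mul_left_cancel₀ (hg'.pos (φ x 0)).ne' ?_
    rw [← hv]
    ring
  have hdiff (x : Coord d) :
      HasFDerivAt (fun y : Coord d => φ y 0 - ε * y 0) (0 : Coord d →L[ℝ] ℝ) x := by
    have hφ0 := (EuclideanSpace.proj (𝕜 := ℝ) (0 : Fin (d + 1))).hasFDerivAt.comp x
      (hφ x).hasFDerivAt
    have hx0 := hasFDerivAt_comp_time (x := x) (hasDerivAt_id (x 0))
    refine (hφ0.sub (hx0.const_mul ε)).congr_fderiv ?_
    ext v
    simp [hderiv]
  have hconst := is_const_of_fderiv_eq_zero (fun y => (hdiff y).differentiableAt)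
    (fun y => (hdiff y).fderiv) x 0
  simp only [PiLp.zero_apply, mul_zero, sub_zero] at hconst
  linarith

theorem exists_scaleFactor_eq_mul (hg : HasScaleFactor a g) (hg' : HasScaleFactor b g') {ε s : ℝ}
    (hε : ε * ε = 1)
    (h : ∀ t, a t * deriv b (ε * t + s) = deriv a t * (ε * b (ε * t + s))) :
    ∃ c : ℝ, ∀ t, a t = c * b (ε * t + s) := by
  have hb (t : ℝ) := hg'.pos (ε * t + s)
  have hquot (t : ℝ) : HasDerivAt (fun t => a t / b (ε * t + s)) 0 t := by
    have hlin : HasDerivAt (fun t => ε * t + s) ε t := by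
      simpa using ((hasDerivAt_id t).const_mul ε).add_const s
    refine ((hg.hasDerivAt t).div ((hg'.hasDerivAt _).comp t hlin) (hb t).ne').congr_deriv ?_
    rw [Function.comp_apply, div_eq_zero_iff]
    left
    linear_combination -ε * h t - deriv a t * b (ε * t + s) * hε
  refine ⟨a 0 / b (ε * 0 + s), fun t => ?_⟩
  rw [← is_const_of_deriv_eq_zero (fun t => (hquot t).differentiableAt)
    (fun t => (hquot t).deriv) t 0, div_mul_cancel₀ _ (hb t).ne']

theorem HasScaleFactor.exists_affine_time_of_transforms (hg : HasScaleFactor a g)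
    (hg' : HasScaleFactor b g') (h : Transforms φ g g') (hd : 1 ≤ d) {s t u : ℝ} (hst : s < t)
    (hs : deriv a s = 0) (ht : deriv a t = 0) (hu : deriv a u ≠ 0) :
    ∃ ε r c : ℝ, (ε = 1 ∨ ε = -1) ∧ (∀ x, φ x 0 = ε * x 0 + r) ∧
      ∀ t, a t = c * b (ε * t + r) := by
  have hZ := isConcircular_pullbackTime hg' h
  have hspace (x : Coord d) (i : Fin d) := hg.space_eq_zero hZ hst hs ht hu i x
  obtain ⟨ε, hε, hZε⟩ := exists_sign_pullbackTime_zero hg hg' h hspace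
  obtain ⟨r, htime⟩ : ∃ r : ℝ, ∀ x, φ x 0 = ε * x 0 + r :=
    ⟨φ 0 0, coordChange_time_eq hg hg' h hspace hZε⟩
  obtain ⟨i⟩ : Nonempty (Fin d) := ⟨0, hd⟩
  have hode (t : ℝ) : a t * deriv b (ε * t + r) = deriv a t * (ε * b (ε * t + r)) := by
    have hi := hg.fderiv_mul_space hZ i (t • timeVec d) (spaceVec i)
    have ht0 : (t • timeVec d) 0 = t := by simp
    rw [hZε, htime, ht0] at hi
    exact sub_eq_zero.1 (by simpa [hspace] using hi.symm)
  obtain ⟨c, hc⟩ := exists_scaleFactor_eq_mul hg hg' (mul_self_eq_one_iff.2 hε) hode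
  exact ⟨ε, r, c, hε, htime, hc⟩

theorem HasRWForm.exists_affine_time_of_transforms {J K : ℝ → ℝ} (hg : HasRWForm J g)
    (hg' : HasRWForm K g') (hJ : ContDiff ℝ ∞ J) (hJpos : ∀ t, 0 < J t) (hK : ContDiff ℝ ∞ K)
    (hKpos : ∀ t, 0 < K t) (h : Transforms φ g g') (hd : 1 ≤ d) {s t u : ℝ} (hst : s < t)
    (hs : deriv J s = 0) (ht : deriv J t = 0) (hu : deriv J u ≠ 0) :
    ∃ ε r c : ℝ, (ε = 1 ∨ ε = -1) ∧ (∀ x, φ x 0 = ε * x 0 + r) ∧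
      ∀ t, J t = c * K (ε * t + r) := by
  have hsqrt (r : ℝ) : deriv (fun t => √(J t)) r = deriv J r / (2 * √(J r)) :=
    deriv_sqrt (hJ.differentiable (by simp) r) (hJpos r).ne'
  obtain ⟨ε, r, c, hε, hT, hc⟩ :=
    (hg.hasScaleFactor_sqrt hJ hJpos).exists_affine_time_of_transforms
      (hg'.hasScaleFactor_sqrt hK hKpos) h hd hst (by rw [hsqrt, hs, zero_div])
      (by rw [hsqrt, ht, zero_div])
      (by rw [hsqrt]; exact div_ne_zero hu (mul_pos two_pos (Real.sqrt_pos.2 (hJpos u))).ne')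
  refine ⟨ε, r, c ^ 2, hε, hT, fun t => ?_⟩
  rw [← Real.sq_sqrt (hJpos t).le, ← Real.sq_sqrt (hKpos _).le, hc, mul_pow]

end Rigidity

/-! ### Extension by zero -/

section FlatFunctions

variable {F : Type*} [NormedAddCommGroup F] [NormedSpace ℝ F]

theorem iteratedDeriv_eq_zero_of_mem_closure {f : ℝ → F} {n : ℕ} (hf : ContDiff ℝ n f) {s : Set ℝ}
    (hs : IsOpen s) (h : EqOn f 0 s) {t : ℝ} (ht : t ∈ closure s) : iteratedDeriv n f t = 0 := by
  have hopen : EqOn (iteratedDeriv n f) 0 s := fun u hu => by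
    simpa using (h.eventuallyEq_of_mem (hs.mem_nhds hu)).iteratedDeriv_eq n
  exact hopen.closure (hf.continuous_iteratedDeriv n le_rfl) continuous_zero ht

theorem hasDerivAt_indicator {s : Set ℝ} (hs : IsClosed s) {f f' : ℝ → F}
    (hf : ∀ t ∈ s, HasDerivWithinAt f (f' t) s t) (h : EqOn f 0 (frontier s))
    (h' : EqOn f' 0 (frontier s)) (t : ℝ) : HasDerivAt (s.indicator f) (s.indicator f' t) t := by
  have hzero {k : ℝ → F} (hk : EqOn k 0 (frontier s)) : EqOn (s.indicator k) 0 (closure sᶜ) := by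
    intro u hu
    by_cases hus : u ∈ s
    · rw [indicator_of_mem hus, hk]
      rw [frontier_eq_closure_inter_closure]
      exact ⟨subset_closure hus, hu⟩
    · exact indicator_of_notMem hus k
  have hin : HasDerivWithinAt (s.indicator f) (s.indicator f' t) s t := by
    by_cases ht : t ∈ s
    · rw [indicator_of_mem ht]
      exact (hf t ht).congr (fun u hu => indicator_of_mem hu f) (indicator_of_mem ht f)
    · exact HasFDerivWithinAt.of_notMem_closure (by rwa [hs.closure_eq])
  have hout : HasDerivWithinAt (s.indicator f) (s.indicator f' t) (closure sᶜ) t := by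
    by_cases ht : t ∈ closure sᶜ
    · rw [hzero h' ht]
      exact (hasDerivWithinAt_const t _ 0).congr (hzero h) (hzero h ht)
    · exact HasFDerivWithinAt.of_notMem_closure (by rwa [closure_closure])
  have hunion : s ∪ closure sᶜ = univ :=
    eq_univ_of_univ_subset ((union_compl_self s).symm.subset.trans
      (union_subset_union_right s subset_closure))
  simpa only [hunion, hasDerivWithinAt_univ] using hin.union hout

theorem contDiff_indicator_of_iteratedDerivWithin_eq_zero {s : Set ℝ} (hs : IsClosed s)
    (hs' : UniqueDiffOn ℝ s) {f : ℝ → F} (hf : ContDiffOn ℝ ∞ f s)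
    (h : ∀ n, EqOn (iteratedDerivWithin n f s) 0 (frontier s)) : ContDiff ℝ ∞ (s.indicator f) := by
  have hderiv (n : ℕ) (t : ℝ) : HasDerivAt (s.indicator (iteratedDerivWithin n f s))
      (s.indicator (iteratedDerivWithin (n + 1) f s) t) t := by
    refine hasDerivAt_indicator hs (fun u hu => ?_) (h n) (h (n + 1)) t
    rw [iteratedDerivWithin_succ]
    exact (hf.differentiableOn_iteratedDerivWithin (mod_cast WithTop.coe_lt_top n)
      hs' u hu).hasDerivWithinAt
  have hcontDiff (m n : ℕ) : ContDiff ℝ m (s.indicator (iteratedDerivWithin n f s)) := by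
    induction m generalizing n with
    | zero =>
      exact contDiff_zero.2 (continuous_iff_continuousAt.2 fun t => (hderiv n t).continuousAt)
    | succ m ih =>
      rw [Nat.cast_succ, contDiff_succ_iff_deriv]
      refine ⟨fun t => (hderiv n t).differentiableAt, by simp, ?_⟩
      rw [funext fun t => (hderiv n t).deriv]
      exact ih (n + 1)
  rw [← iteratedDerivWithin_zero (f := f) (s := s)]
  exact contDiff_infty.2 fun m => hcontDiff m 0

end FlatFunctions

/-! ### A bell curve -/

/-- The bell curve `exp (-(3x - 1)² / (x (1 - x))) = exp (9 - 1 / x - 4 / (1 - x))` on `(0, 1)` with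
peak at `1 / 3`, extended by zero. -/
noncomputable def skewBell (x : ℝ) : ℝ :=
  Real.exp 9 * (expNegInvGlue x * expNegInvGlue ((1 - x) / 4))

theorem contDiff_skewBell {n : ℕ∞} : ContDiff ℝ n skewBell :=
  contDiff_const.mul (expNegInvGlue.contDiff.mul (expNegInvGlue.contDiff.comp (by fun_prop)))

theorem skewBell_of_nonpos {x : ℝ} (hx : x ≤ 0) : skewBell x = 0 := by
  simp [skewBell, expNegInvGlue.zero_of_nonpos hx]

theorem skewBell_of_one_le {x : ℝ} (hx : 1 ≤ x) : skewBell x = 0 := by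
  simp [skewBell, expNegInvGlue.zero_of_nonpos (show (1 - x) / 4 ≤ 0 by linarith)]

theorem skewBell_of_mem_Ioo {x : ℝ} (hx : x ∈ Ioo (0 : ℝ) 1) :
    skewBell x = Real.exp (-((3 * x - 1) ^ 2 / (x * (1 - x)))) := by
  have hx0 : x ≠ 0 := hx.1.ne'
  have hx1 : 1 - x ≠ 0 := (sub_pos.2 hx.2).ne'
  have hx4 : 0 < (1 - x) / 4 := by linarith [hx.2]
  rw [skewBell, expNegInvGlue, expNegInvGlue, if_neg hx.1.not_ge, if_neg hx4.not_ge,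
    ← Real.exp_add, ← Real.exp_add]
  congr 1
  field_simp
  ring

theorem skewBell_nonneg (x : ℝ) : 0 ≤ skewBell x :=
  mul_nonneg (Real.exp_pos _).le (mul_nonneg (expNegInvGlue.nonneg _) (expNegInvGlue.nonneg _))

theorem skewBell_le_one (x : ℝ) : skewBell x ≤ 1 := by
  rcases le_or_gt x 0 with h0 | h0
  · simp [skewBell_of_nonpos h0]
  rcases le_or_gt 1 x with h1 | h1
  · simp [skewBell_of_one_le h1]
  rw [skewBell_of_mem_Ioo ⟨h0, h1⟩, Real.exp_le_one_iff, neg_nonpos]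
  exact div_nonneg (sq_nonneg _) (mul_pos h0 (sub_pos.2 h1)).le

theorem skewBell_eq_one_iff {x : ℝ} : skewBell x = 1 ↔ x = 1 / 3 := by
  rcases le_or_gt x 0 with h0 | h0
  · rw [skewBell_of_nonpos h0]
    exact iff_of_false zero_ne_one (by linarith)
  rcases le_or_gt 1 x with h1 | h1
  · rw [skewBell_of_one_le h1]
    exact iff_of_false zero_ne_one (by linarith)
  rw [skewBell_of_mem_Ioo ⟨h0, h1⟩, Real.exp_eq_one_iff, neg_eq_zero, div_eq_zero_iff,
    or_iff_left (mul_pos h0 (sub_pos.2 h1)).ne', sq_eq_zero_iff]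
  constructor <;> intro h <;> linarith

theorem iteratedDerivWithin_skewBell_eq_zero {s : Set ℝ} (hs : IsOpen s) (h : EqOn skewBell 0 s)
    {t : ℝ} (ht : t ∈ closure s) (ht' : t ∈ Icc (0 : ℝ) 1) (n : ℕ) :
    iteratedDerivWithin n skewBell (Icc 0 1) t = 0 := by
  rw [iteratedDerivWithin_eq_iteratedDeriv (uniqueDiffOn_Icc zero_lt_one)
    contDiff_skewBell.contDiffAt ht']
  exact iteratedDeriv_eq_zero_of_mem_closure contDiff_skewBell hs h ht

theorem isBellCurve_skewBell : IsBellCurve skewBell where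
  smooth := contDiff_skewBell.contDiffOn
  mapsTo x _ := ⟨skewBell_nonneg x, skewBell_le_one x⟩
  flat_zero := iteratedDerivWithin_skewBell_eq_zero isOpen_Iio
    (fun _ hx => skewBell_of_nonpos (le_of_lt hx)) (by simp) (by simp)
  flat_one := iteratedDerivWithin_skewBell_eq_zero isOpen_Ioi
    (fun _ hx => skewBell_of_one_le (le_of_lt hx)) (by simp) (by simp)
  peak := ⟨1 / 3, by norm_num, by norm_num, skewBell_eq_one_iff.2 rfl,
    fun _ _ => skewBell_eq_one_iff.1⟩
  asymmetric := by
    rintro ⟨c, hc⟩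
    have hpeak : Int.fract (2 * c - 1 / 3) = 1 / 3 := by
      have hfract : Int.fract (1 / 3 : ℝ) = 1 / 3 := Int.fract_eq_self.2 (by norm_num)
      rw [← skewBell_eq_one_iff, hc, hfract, skewBell_eq_one_iff]
    have hzero : Int.fract (2 * c - 0) = 2 / 3 := by
      refine Int.fract_eq_iff.2 ⟨by norm_num, by norm_num, ⌊2 * c - 1 / 3⌋, ?_⟩
      linarith [Int.floor_add_fract (2 * c - 1 / 3)]
    have h := hc 0
    rw [hzero, Int.fract_zero, skewBell_of_nonpos le_rfl, skewBell_of_mem_Ioo (by norm_num)] at h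
    exact (Real.exp_pos _).ne' h

/-! ### The functions `W_α` -/

/-- The sign of the bell curve that `W_α` carries over `[n, n + 1]` when `α n = b`. -/
def letterSign (b : Bool) : ℝ := if b then 1 else -1

theorem letterSign_injective : Function.Injective letterSign := by
  intro a b h
  cases a <;> cases b <;> first | rfl | norm_num [letterSign] at h

theorem abs_letterSign (b : Bool) : |letterSign b| = 1 := by
  cases b <;> simp [letterSign]

theorem bellWave_eq (W : ℝ → ℝ) (α : Bernoulli) (t : ℝ) :
    bellWave W α t = 2 + letterSign (α ⌊t⌋) * W (Int.fract t) := by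
  unfold bellWave letterSign Int.fract
  split_ifs <;> ring

theorem bellWave_congr (W : ℝ → ℝ) {α β : Bernoulli} {t : ℝ} (h : α ⌊t⌋ = β ⌊t⌋) :
    bellWave W α t = bellWave W β t := by
  rw [bellWave_eq, bellWave_eq, h]

theorem bellWave_ofAdd_smul (W : ℝ → ℝ) (k : ℤ) (α : Bernoulli) (t : ℝ) :
    bellWave W (Multiplicative.ofAdd k • α) t = bellWave W α (t - k) := by
  rw [bellWave_eq, bellWave_eq, Int.fract_sub_intCast, Int.floor_sub_intCast]
  rfl

namespace IsBellCurve

variable {W : ℝ → ℝ}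

theorem apply_zero (hW : IsBellCurve W) : W 0 = 0 := by
  simpa using hW.flat_zero 0

theorem apply_one (hW : IsBellCurve W) : W 1 = 0 := by
  simpa using hW.flat_one 0

theorem apply_fract_mem_Icc (hW : IsBellCurve W) (t : ℝ) : W (Int.fract t) ∈ Icc (0 : ℝ) 1 :=
  hW.mapsTo ⟨Int.fract_nonneg t, (Int.fract_lt_one t).le⟩

theorem contDiff_indicator (hW : IsBellCurve W) : ContDiff ℝ ∞ ((Icc 0 1).indicator W) := by
  refine contDiff_indicator_of_iteratedDerivWithin_eq_zero isClosed_Icc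
    (uniqueDiffOn_Icc zero_lt_one) hW.smooth fun n t ht => ?_
  rw [frontier_Icc zero_le_one] at ht
  rcases ht with rfl | rfl
  exacts [hW.flat_zero n, hW.flat_one n]

theorem indicator_of_nonpos (hW : IsBellCurve W) {t : ℝ} (ht : t ≤ 0) :
    (Icc 0 1).indicator W t = 0 := by
  rcases ht.eq_or_lt with rfl | ht
  · rw [indicator_of_mem (by simp), hW.apply_zero]
  · exact indicator_of_notMem (fun h => ht.not_ge h.1) W

theorem indicator_of_one_le (hW : IsBellCurve W) {t : ℝ} (ht : 1 ≤ t) :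
    (Icc 0 1).indicator W t = 0 := by
  rcases ht.eq_or_lt with rfl | ht
  · rw [indicator_of_mem (by simp), hW.apply_one]
  · exact indicator_of_notMem (fun h => ht.not_ge h.2) W

theorem bellWave_eq_of_mem_Ioo (hW : IsBellCurve W) (α : Bernoulli) {n : ℤ} {t : ℝ}
    (ht : t ∈ Ioo (n - 1 : ℝ) (n + 1)) :
    bellWave W α t = 2 + letterSign (α (n - 1)) * (Icc 0 1).indicator W (t - (n - 1)) +
      letterSign (α n) * (Icc 0 1).indicator W (t - n) := by
  rw [bellWave_eq]
  rcases lt_or_ge t n with h | h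
  · have hfloor : ⌊t⌋ = n - 1 :=
      Int.floor_eq_iff.2 ⟨by push_cast; exact ht.1.le, by push_cast; linarith⟩
    rw [hW.indicator_of_nonpos (t := t - n) (by linarith),
      indicator_of_mem (mem_Icc.2 ⟨by linarith [ht.1], by linarith⟩), ← Int.self_sub_floor, hfloor]
    push_cast
    ring
  · have hfloor : ⌊t⌋ = n := Int.floor_eq_iff.2 ⟨h, ht.2⟩
    rw [hW.indicator_of_one_le (t := t - (n - 1)) (by linarith),
      indicator_of_mem (mem_Icc.2 ⟨by linarith, by linarith [ht.2]⟩), ← Int.self_sub_floor, hfloor]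
    ring

theorem contDiff_bellWave (hW : IsBellCurve W) (α : Bernoulli) : ContDiff ℝ ∞ (bellWave W α) := by
  refine contDiff_iff_contDiffAt.2 fun t => ?_
  have ht : Ioo (⌊t⌋ - 1 : ℝ) (⌊t⌋ + 1) ∈ nhds t :=
    Ioo_mem_nhds (by linarith [Int.floor_le t]) (Int.lt_floor_add_one t)
  have hpiece (r s : ℝ) : ContDiff ℝ ∞ fun t => r * (Icc 0 1).indicator W (t - s) :=
    contDiff_const.mul (hW.contDiff_indicator.comp (contDiff_id.sub contDiff_const))
  exact ((contDiff_const.add (hpiece _ _)).add (hpiece _ _)).contDiffAt.congr_of_eventuallyEq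
    (Filter.eventually_of_mem ht fun _ => hW.bellWave_eq_of_mem_Ioo α)

theorem abs_bellWave_sub_two (hW : IsBellCurve W) (α : Bernoulli) (t : ℝ) :
    |bellWave W α t - 2| = W (Int.fract t) := by
  rw [bellWave_eq, add_sub_cancel_left, abs_mul, abs_letterSign, one_mul,
    abs_of_nonneg (hW.apply_fract_mem_Icc t).1]

theorem bellWave_mem_Icc (hW : IsBellCurve W) (α : Bernoulli) (t : ℝ) :
    bellWave W α t ∈ Icc (1 : ℝ) 3 := by
  have h := abs_le.1 ((hW.abs_bellWave_sub_two α t).trans_le (hW.apply_fract_mem_Icc t).2)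
  constructor <;> linarith [h.1, h.2]

theorem bellWave_pos (hW : IsBellCurve W) (α : Bernoulli) (t : ℝ) : 0 < bellWave W α t :=
  zero_lt_one.trans_le (hW.bellWave_mem_Icc α t).1

theorem bellWave_zero (hW : IsBellCurve W) (α : Bernoulli) : bellWave W α 0 = 2 := by
  rw [bellWave_eq, Int.fract_zero, hW.apply_zero, mul_zero, add_zero]

theorem exists_peak (hW : IsBellCurve W) : ∃ p : ℝ, Int.fract p = p ∧
    (∀ t, W (Int.fract t) = 1 ↔ Int.fract t = p) ∧
    ∀ (α : Bernoulli) (n : ℤ), bellWave W α (n + p) = 2 + letterSign (α n) := by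
  obtain ⟨p, hp, hp2, hWp, hunique⟩ := hW.peak
  have hp1 : p ∈ Ico (0 : ℝ) 1 := ⟨hp.1, by linarith⟩
  have hfract : Int.fract p = p := Int.fract_eq_self.2 hp1
  refine ⟨p, hfract, fun t => ⟨?_, fun h => h ▸ hWp⟩, fun α n => ?_⟩
  · exact hunique _ ⟨Int.fract_nonneg t, (Int.fract_lt_one t).le⟩
  · rw [bellWave_eq, Int.fract_intCast_add, hfract, hWp, Int.floor_intCast_add,
      Int.floor_eq_zero_iff.2 hp1, add_zero, mul_one]

theorem deriv_bellWave_eq_zero (hW : IsBellCurve W) (α : Bernoulli) {t : ℝ}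
    (ht : W (Int.fract t) = 1) : deriv (bellWave W α) t = 0 := by
  have habs := hW.abs_bellWave_sub_two α t
  rw [ht, abs_eq zero_le_one] at habs
  rcases habs with hmax | hmin
  · refine IsLocalMax.deriv_eq_zero (.of_forall fun u => ?_)
    linarith [(hW.bellWave_mem_Icc α u).2]
  · refine IsLocalMin.deriv_eq_zero (.of_forall fun u => ?_)
    linarith [(hW.bellWave_mem_Icc α u).1]

theorem exists_deriv_bellWave_ne_zero (hW : IsBellCurve W) (α : Bernoulli) :
    ∃ t, deriv (bellWave W α) t ≠ 0 := by
  by_contra! h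
  obtain ⟨p, -, -, hp⟩ := hW.exists_peak
  have hconst := is_const_of_deriv_eq_zero ((hW.contDiff_bellWave α).differentiable (by simp)) h
    ((0 : ℤ) + p) 0
  rw [hp, hW.bellWave_zero, add_eq_left] at hconst
  simpa [hconst] using abs_letterSign (α 0)

theorem isGreatest_range_bellWave (hW : IsBellCurve W) (α : Bernoulli)
    [Decidable (∃ n, α n = true)] :
    IsGreatest (range (bellWave W α)) (if ∃ n, α n = true then 3 else 2) := by
  split_ifs with h
  · obtain ⟨n, hn⟩ := h
    obtain ⟨p, -, -, hp⟩ := hW.exists_peak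
    refine ⟨⟨n + p, ?_⟩, forall_mem_range.2 fun t => (hW.bellWave_mem_Icc α t).2⟩
    norm_num [hp, hn, letterSign]
  · refine ⟨⟨0, hW.bellWave_zero α⟩, forall_mem_range.2 fun t => ?_⟩
    rw [bellWave_eq, letterSign, if_neg fun ht => h ⟨_, ht⟩]
    linarith [(hW.apply_fract_mem_Icc t).1]

theorem isLeast_range_bellWave (hW : IsBellCurve W) (α : Bernoulli)
    [Decidable (∃ n, α n = false)] :
    IsLeast (range (bellWave W α)) (if ∃ n, α n = false then 1 else 2) := by
  split_ifs with h
  · obtain ⟨n, hn⟩ := h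
    obtain ⟨p, -, -, hp⟩ := hW.exists_peak
    refine ⟨⟨n + p, ?_⟩, forall_mem_range.2 fun t => (hW.bellWave_mem_Icc α t).1⟩
    norm_num [hp, hn, letterSign]
  · refine ⟨⟨0, hW.bellWave_zero α⟩, forall_mem_range.2 fun t => ?_⟩
    rw [bellWave_eq, letterSign, if_pos (by simpa using fun ht => h ⟨_, ht⟩)]
    linarith [(hW.apply_fract_mem_Icc t).1]

theorem eq_one_of_bellWave_eq_mul (hW : IsBellCurve W) {α β : Bernoulli} {c : ℝ} {σ : ℝ → ℝ}
    (hσ : σ.Surjective) (h : ∀ t, bellWave W α t = c * bellWave W β (σ t)) : c = 1 := by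
  classical
  have hc : 0 < c :=
    pos_of_mul_pos_left (h 0 ▸ hW.bellWave_pos α 0) (hW.bellWave_pos β (σ 0)).le
  have hrange : range (bellWave W α) = (c * ·) '' range (bellWave W β) := by
    rw [← hσ.range_comp (bellWave W β), ← range_comp]
    exact congrArg range (funext h)
  have hmono : Monotone (c * ·) := monotone_mul_left_of_nonneg hc.le
  have hmax := (hrange ▸ hW.isGreatest_range_bellWave α).unique
    (hmono.map_isGreatest (hW.isGreatest_range_bellWave β))
  have hmin := (hrange ▸ hW.isLeast_range_bellWave α).unique
    (hmono.map_isLeast (hW.isLeast_range_bellWave β))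
  -- The extreme values of `W_α` are determined by their ratio, which `c` does not change.
  split_ifs at hmax hmin <;> linarith

theorem exists_intCast_of_bellWave_eq (hW : IsBellCurve W) {α β : Bernoulli} {s : ℝ}
    (h : ∀ t, bellWave W α t = bellWave W β (t + s)) :
    ∃ k : ℤ, s = -k ∧ ∀ n : ℤ, α n = β (n - k) := by
  obtain ⟨p, hfract, hpeak, hp⟩ := hW.exists_peak
  have hs : s = ⌊p + s⌋ := by
    have hps : W (Int.fract (p + s)) = 1 := by
      rw [← hW.abs_bellWave_sub_two β, ← h, hW.abs_bellWave_sub_two, hpeak, hfract]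
    linarith [Int.floor_add_fract (p + s), (hpeak _).1 hps]
  refine ⟨-⌊p + s⌋, by push_cast; linarith, fun n => letterSign_injective ?_⟩
  have hn := h (n + p)
  rw [hs, add_right_comm, ← Int.cast_add, hp, hp] at hn
  rw [sub_neg_eq_add]
  linarith

theorem exists_shift_of_bellWave_eq (hW : IsBellCurve W) {α β : Bernoulli} {c ε s : ℝ}
    (hε : ε = 1 ∨ ε = -1) (h : ∀ t, bellWave W α t = c * bellWave W β (ε * t + s)) :
    ∃ k : ℤ, (∀ t, ε * t + s = t - k) ∧ ∀ n : ℤ, α n = β (n - k) := by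
  have hσ : Function.Surjective fun t : ℝ => ε * t + s := fun y =>
    ⟨ε * (y - s), by linear_combination (y - s) * mul_self_eq_one_iff.2 hε⟩
  obtain rfl := hW.eq_one_of_bellWave_eq_mul hσ h
  simp only [one_mul] at h
  rcases hε with rfl | rfl
  · simp only [one_mul] at h ⊢
    obtain ⟨k, rfl, hk⟩ := hW.exists_intCast_of_bellWave_eq h
    exact ⟨k, fun t => (sub_eq_add_neg t k).symm, hk⟩
  · refine absurd ⟨s / 2, fun t => ?_⟩ hW.asymmetric
    rw [← hW.abs_bellWave_sub_two α t, h, hW.abs_bellWave_sub_two]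
    congr 2
    ring

end IsBellCurve

/-! ### Generic ergodicity of the Bernoulli shift -/

theorem exists_dense_orbit (M X : Type*) [Monoid M] [MulAction M X] [TopologicalSpace X]
    [ContinuousConstSMul M X] [SecondCountableTopology X] [BaireSpace X] [Nonempty X]
    [MulAction.IsTopologicallyTransitive M X] : ∃ x : X, Dense (MulAction.orbit M x) := by
  have hbasis := TopologicalSpace.isBasis_countableBasis X
  obtain ⟨x, hx⟩ := (dense_biInter_of_isOpen
    (fun U hU => isOpen_iUnion fun m : M => (hbasis.isOpen hU).preimage (continuous_const_smul m))
    (TopologicalSpace.countable_countableBasis X) fun U hU =>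
      (hbasis.isOpen hU).dense_iUnion_preimage_smul M
        (TopologicalSpace.nonempty_of_mem_countableBasis hU)).nonempty
  refine ⟨x, hbasis.dense_iff.2 fun U hU _ => ?_⟩
  obtain ⟨m, hm⟩ := mem_iUnion.1 (mem_iInter₂.1 hx U hU)
  exact ⟨m • x, hm, MulAction.mem_orbit x m⟩

theorem isMeagre_of_countable {X : Type*} [TopologicalSpace X] [T1Space X] [PerfectSpace X]
    {s : Set X} (hs : s.Countable) : IsMeagre s := by
  have hsingleton (x : X) : IsMeagre {x} :=
    (isClosed_singleton.isNowhereDense_iff.2 (interior_singleton x)).isMeagre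
  have := hs.to_subtype
  simpa using isMeagre_iUnion fun x : s => hsingleton x

namespace Bernoulli

instance : PolishSpace Bernoulli :=
  have : TopologicalSpace.IsCompletelyMetrizableSpace (ℤ → Bool) := inferInstance
  have : SecondCountableTopology (ℤ → Bool) := inferInstance
  inferInstanceAs (PolishSpace (ℤ → Bool))

theorem continuous_eval (n : ℤ) : Continuous fun α : Bernoulli => α n :=
  continuous_apply (A := fun _ : ℤ => Bool) n

instance : ContinuousSMul (Multiplicative ℤ) Bernoulli :=
  ⟨continuous_prod_of_discrete_left.2 fun k =>
    continuous_pi (A := fun _ : ℤ => Bool) fun n => continuous_eval (n - k.toAdd)⟩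

theorem eventually_eqOn (α : Bernoulli) {I : Set ℤ} (hI : I.Finite) :
    ∀ᶠ β in nhds α, EqOn β α I :=
  (Filter.eventually_all_finite hI).2 fun n _ =>
    (continuous_eval n).continuousAt.preimage_mem_nhds ((isOpen_discrete {α n}).mem_nhds rfl)

theorem exists_eqOn_Icc_subset {α : Bernoulli} {U : Set Bernoulli} (hU : U ∈ nhds α) :
    ∃ N : ℕ, ∀ β : Bernoulli, EqOn β α (Icc (-N) N) → β ∈ U := by
  have hU' : U ∈ Filter.pi fun n : ℤ => nhds (α n) :=
    nhds_pi (A := fun _ : ℤ => Bool) (a := α) ▸ hU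
  obtain ⟨I, hI, t, ht, hsub⟩ := Filter.mem_pi.1 hU'
  obtain ⟨N, hN⟩ := (hI.image Int.natAbs).bddAbove
  refine ⟨N, fun β hβ => hsub fun n hn => ?_⟩
  have hnN : n.natAbs ≤ N := hN (mem_image_of_mem _ hn)
  rw [hβ (mem_Icc.2 (by omega))]
  exact mem_of_mem_nhds (ht n)

instance : PerfectSpace Bernoulli := by
  refine perfectSpace_iff_forall_not_isolated.2 fun α => ?_
  have hflip : Filter.Tendsto (fun m : ℤ => Function.update α m (!α m)) Filter.cofinite
      (nhdsWithin α {α}ᶜ) := by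
    refine tendsto_nhdsWithin_iff.2 ⟨tendsto_pi_nhds.2 fun n => ?_, .of_forall fun m => ?_⟩
    · refine tendsto_nhds_of_eventually_eq ?_
      filter_upwards [(finite_singleton n).compl_mem_cofinite] with m hm
      exact Function.update_of_ne (Ne.symm hm) _ _
    · exact fun h => Bool.not_ne_self _ (Function.update_eq_self_iff.1 h)
  exact hflip.neBot

instance : MulAction.IsTopologicallyTransitive (Multiplicative ℤ) Bernoulli where
  exists_smul_inter {U V} hU hUne hV hVne := by
    obtain ⟨α, hα⟩ := hUne
    obtain ⟨β, hβ⟩ := hVne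
    obtain ⟨M, hM⟩ := exists_eqOn_Icc_subset (hU.mem_nhds hα)
    obtain ⟨N, hN⟩ := exists_eqOn_Icc_subset (hV.mem_nhds hβ)
    let k : ℤ := M + N + 1
    let γ : Bernoulli := fun n => if n ≤ M then α n else β (n - k)
    have hγ : γ ∈ U := hM γ fun n hn => if_pos hn.2
    have hkγ : (Multiplicative.ofAdd (-k) • γ) ∈ V := hN _ fun n hn => by
      have hn' : n - -k = n + k := sub_neg_eq_add n k
      change γ (n - -k) = β n
      simp only [γ, hn', if_neg (show ¬n + k ≤ M by have := hn.1; omega), add_sub_cancel_right]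
    exact ⟨_, _, smul_mem_smul_set hγ, hkγ⟩

theorem isGenericallyErgodicPolish :
    IsGenericallyErgodicPolish (Multiplicative ℤ) Bernoulli where
  topologicalGroup := inferInstance
  polish_group := inferInstanceAs (PolishSpace ℤ)
  polish_space := inferInstance
  continuous_action := inferInstance
  dense_orbit :=
    have : Nonempty Bernoulli := ⟨fun _ => true⟩
    exists_dense_orbit (Multiplicative ℤ) Bernoulli
  meagre_orbits α :=
    have : Countable (Multiplicative ℤ) := inferInstanceAs (Countable ℤ)
    isMeagre_of_countable (countable_range fun k : Multiplicative ℤ => k • α)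

end Bernoulli

/-! ### The reduction -/

section RobertsonWalkerSpacetime

variable {d : ℕ}

/-- The bilinear form `dt²`. -/
noncomputable def timeForm (d : ℕ) : BilForm d :=
  (EuclideanSpace.proj (𝕜 := ℝ) (0 : Fin (d + 1))).smulRight
    (EuclideanSpace.proj (𝕜 := ℝ) (0 : Fin (d + 1)))

/-- The bilinear form `(dx¹)² + ⋯ + (dx^d)²`. -/
noncomputable def spaceForm (d : ℕ) : BilForm d :=
  ∑ i : Fin d, (EuclideanSpace.proj (𝕜 := ℝ) i.succ).smulRight
    (EuclideanSpace.proj (𝕜 := ℝ) i.succ)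

/-- The metric tensor field `-dt² + J(t) ((dx¹)² + ⋯ + (dx^d)²)`. -/
noncomputable def rwMetric (d : ℕ) (J : ℝ → ℝ) (x : Coord d) : BilForm d :=
  -timeForm d + J (x 0) • spaceForm d

theorem rwMetric_apply (J : ℝ → ℝ) (x v w : Coord d) :
    rwMetric d J x v w = -(v 0 * w 0) + J (x 0) * ∑ i : Fin d, v i.succ * w i.succ := by
  simp [rwMetric, timeForm, spaceForm]

theorem contDiff_rwMetric {J : ℝ → ℝ} (hJ : ContDiff ℝ ∞ J) : ContDiff ℝ ∞ (rwMetric d J) := by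
  refine contDiff_clm_apply_iff.2 fun v => contDiff_clm_apply_iff.2 fun w => ?_
  simp only [rwMetric_apply]
  exact contDiff_const.add ((hJ.comp (EuclideanSpace.proj (𝕜 := ℝ) (0 : Fin (d + 1))).contDiff).mul
    contDiff_const)

theorem isLorentzian_rwMetric {J : ℝ → ℝ} (hpos : ∀ t, 0 < J t) (x : Coord d) :
    IsLorentzian (rwMetric d J x) := by
  have hs : √(J (x 0)) ≠ 0 := (Real.sqrt_pos.2 (hpos _)).ne'
  let u : Fin (d + 1) → ℝˣ := Fin.cons 1 fun _ => (Units.mk0 _ hs)⁻¹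
  let e := (EuclideanSpace.basisFun (Fin (d + 1)) ℝ).toBasis.unitsSMul u
  have he (i : Fin (d + 1)) : e i = (u i : ℝ) • EuclideanSpace.single i (1 : ℝ) := by
    simp [e, Module.Basis.unitsSMul_apply, Units.smul_def]
  have he0 : e 0 = timeVec d := by simp [he, u, timeVec]
  have hesucc (i : Fin d) : e i.succ = (√(J (x 0)))⁻¹ • spaceVec i := by simp [he, u, spaceVec]
  have hJ : J (x 0) * ((√(J (x 0)))⁻¹ * (√(J (x 0)))⁻¹) = 1 := by
    rw [← mul_inv, Real.mul_self_sqrt (hpos _).le, mul_inv_cancel₀ (hpos _).ne']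
  refine ⟨e, fun i j => ?_⟩
  rw [rwMetric_apply]
  cases i using Fin.cases <;> cases j using Fin.cases
  · simp [he0]
  · simp [he0, hesucc, (Fin.succ_ne_zero _).symm]
  · simp [he0, hesucc]
  · simp [hesucc, hJ, eq_comm]

/-- The Robertson-Walker spacetime `-dt² + J(t) ((dx¹)² + ⋯ + (dx^d)²)`. -/
noncomputable def rwSpacetime (d : ℕ) {J : ℝ → ℝ} (hJ : ContDiff ℝ ∞ J) (hpos : ∀ t, 0 < J t) :
    Spacetime d where
  metric := rwMetric d J
  smooth := contDiff_rwMetric hJ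
  symm x v w := by simp only [rwMetric_apply, mul_comm]
  lorentzian := isLorentzian_rwMetric hpos

theorem hasRWForm_rwSpacetime {J : ℝ → ℝ} (hJ : ContDiff ℝ ∞ J) (hpos : ∀ t, 0 < J t) :
    HasRWForm J (rwSpacetime d hJ hpos) :=
  rwMetric_apply J

/-- The translation `x ↦ x + v` as a change of coordinates. -/
noncomputable def translation (v : Coord d) : CoordChange d where
  toEquiv := Equiv.addRight v
  contMDiff_toFun := (contDiff_id.add contDiff_const).contMDiff
  contMDiff_invFun := (contDiff_id.add contDiff_const).contMDiff

theorem coe_translation (v : Coord d) : ⇑(translation v) = fun x => x + v := rfl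

theorem transforms_translation {J K : ℝ → ℝ} {g g' : Spacetime d} (hg : HasRWForm J g)
    (hg' : HasRWForm K g') {s : ℝ} (h : ∀ t, J t = K (t + s)) :
    Transforms (translation (s • timeVec d)) g g' := by
  intro x v w
  rw [hg, hg', coe_translation, fderiv_add_const, fderiv_fun_id, h]
  simp

end RobertsonWalkerSpacetime

theorem continuous_of_eventually_metric_eventuallyEq {X : Type*} [TopologicalSpace X] {d : ℕ}
    {F : X → Spacetime d}
    (h : ∀ a, ∀ C : Set (Coord d), IsCompact C →
      ∀ᶠ b in nhds a, ∀ x ∈ C, (F b).metric =ᶠ[nhds x] (F a).metric) : Continuous F := by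
  refine continuous_induced_rng.2 (continuous_iInf_rng.2 fun n => continuous_induced_rng.2 ?_)
  refine ContinuousMap.continuous_compactOpen.2 fun C hC U _ => ?_
  refine isOpen_iff_mem_nhds.2 fun a ha => ?_
  filter_upwards [h a C hC] with b hb x hx
  have hjet : iteratedFDeriv ℝ n (F b).metric x = iteratedFDeriv ℝ n (F a).metric x :=
    ((hb x hx).iteratedFDeriv ℝ n).self_of_nhds
  have hxU : iteratedFDeriv ℝ n (F a).metric x ∈ U := ha hx
  rwa [← hjet] at hxU

namespace IsBellCurve

variable {W : ℝ → ℝ}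

/-- The map `α ↦ -dt² + W_α(t) ((dx¹)² + ⋯ + (dx^d)²)`. -/
noncomputable def reduction (d : ℕ) (hW : IsBellCurve W) (α : Bernoulli) : RW d :=
  ⟨rwSpacetime d (hW.contDiff_bellWave α) (hW.bellWave_pos α),
    bellWave W α, hW.contDiff_bellWave α, hW.bellWave_pos α, hasRWForm_rwSpacetime _ _⟩

theorem hasRWForm_reduction (d : ℕ) (hW : IsBellCurve W) (α : Bernoulli) :
    HasRWForm (bellWave W α) (hW.reduction d α : Spacetime d) :=
  hasRWForm_rwSpacetime (hW.contDiff_bellWave α) (hW.bellWave_pos α)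

theorem exists_shift_of_transforms {d : ℕ} (hd : 1 ≤ d) (hW : IsBellCurve W) {α β : Bernoulli}
    {φ : CoordChange d}
    (h : Transforms φ (hW.reduction d α : Spacetime d) (hW.reduction d β : Spacetime d)) :
    ∃ k : ℤ, (∀ x : Coord d, φ x 0 = x 0 - k) ∧ ∀ n : ℤ, α n = β (n - k) := by
  obtain ⟨p, hfract, hpeak, -⟩ := hW.exists_peak
  have hWp : W (Int.fract p) = 1 := (hpeak p).2 hfract
  obtain ⟨u, hu⟩ := hW.exists_deriv_bellWave_ne_zero α
  obtain ⟨ε, s, c, hε, htime, hc⟩ :=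
    (hW.hasRWForm_reduction d α).exists_affine_time_of_transforms (hW.hasRWForm_reduction d β)
      (hW.contDiff_bellWave α) (hW.bellWave_pos α) (hW.contDiff_bellWave β) (hW.bellWave_pos β)
      h hd (lt_add_one p) (hW.deriv_bellWave_eq_zero α hWp)
      (hW.deriv_bellWave_eq_zero α (by rwa [Int.fract_add_one])) hu
  obtain ⟨k, hk, hαβ⟩ := hW.exists_shift_of_bellWave_eq hε hc
  exact ⟨k, fun x => by rw [htime, hk], hαβ⟩

theorem continuous_reduction (d : ℕ) (hW : IsBellCurve W) : Continuous (hW.reduction d) := by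
  refine (continuous_of_eventually_metric_eventuallyEq fun α C hC => ?_).subtype_mk _
  obtain ⟨R, hR⟩ := hC.isBounded.exists_norm_le
  obtain ⟨N, hN⟩ := exists_nat_gt R
  filter_upwards [Bernoulli.eventually_eqOn α (finite_Icc (-N : ℤ) N)] with β hβ x hx
  have hxN : |x 0| < N := (PiLp.norm_apply_le x 0).trans_lt ((hR x hx).trans_lt hN)
  have hopen : IsOpen {y : Coord d | |y 0| < N} := isOpen_lt (by fun_prop) continuous_const
  filter_upwards [hopen.mem_nhds hxN] with y hy
  have hfloor : ⌊y 0⌋ ∈ Icc (-N : ℤ) N := by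
    obtain ⟨hl, hr⟩ := abs_lt.1 (show |y 0| < N from hy)
    exact ⟨Int.le_floor.2 (by push_cast; exact hl.le),
      (Int.floor_lt.2 (by push_cast; exact hr)).le⟩
  change rwMetric d (bellWave W β) y = rwMetric d (bellWave W α) y
  rw [rwMetric, rwMetric, bellWave_congr W (hβ hfloor)]

theorem isBorelReduction_reduction {d : ℕ} (hd : 1 ≤ d) (hW : IsBellCurve W) :
    IsBorelReduction (Multiplicative ℤ) (hW.reduction d) where
  borel_map := (hW.continuous_reduction d).borel_measurable
  reduces α β := by
    rw [MulAction.orbit_eq_iff, MulAction.mem_orbit_iff]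
    constructor
    · rintro ⟨k, rfl⟩
      refine ⟨_, transforms_translation (s := -k.toAdd) (hW.hasRWForm_reduction d _)
        (hW.hasRWForm_reduction d _) fun t => ?_⟩
      rw [← sub_eq_add_neg]
      exact bellWave_ofAdd_smul W k.toAdd β t
    · rintro ⟨φ, hφ⟩
      obtain ⟨k, -, hk⟩ := hW.exists_shift_of_transforms hd hφ
      exact ⟨Multiplicative.ofAdd k, funext fun n => (hk n).symm⟩

end IsBellCurve

theorem mainTheorem4 (d : ℕ) (hd : 1 ≤ d) :
    IsRich (RW d) ∧
    IsGenericallyErgodicPolish (Multiplicative ℤ) Bernoulli ∧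
    (∃ W : ℝ → ℝ, IsBellCurve W) ∧
    ∀ W : ℝ → ℝ, IsBellCurve W →
      ∃ r : Bernoulli → RW d,
        (∀ α : Bernoulli, HasRWForm (bellWave W α) (r α : Spacetime d)) ∧
        Continuous r ∧
        IsBorelReduction (Multiplicative ℤ) r ∧
        ∀ (α β : Bernoulli) (φ : CoordChange d),
          Transforms φ (r α : Spacetime d) (r β : Spacetime d) →
            ∃ k : ℤ, (∀ x : Coord d, φ x 0 = x 0 - k) ∧ ∀ n : ℤ, α n = β (n - k) :=
  ⟨⟨Multiplicative ℤ, Bernoulli, inferInstance, inferInstance, inferInstance, inferInstance,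
      Bernoulli.isGenericallyErgodicPolish, isBellCurve_skewBell.reduction d,
      isBellCurve_skewBell.isBorelReduction_reduction hd⟩,
    Bernoulli.isGenericallyErgodicPolish, ⟨skewBell, isBellCurve_skewBell⟩,
    fun _ hW => ⟨hW.reduction d, hW.hasRWForm_reduction d, hW.continuous_reduction d,
      hW.isBorelReduction_reduction hd, fun _ _ _ h => hW.exists_shift_of_transforms hd h⟩⟩
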